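/- Let $d,K\ge 1$ and let $\pi$ be the probability measure on $\mathbb{R}^d$ with density proportional to $e^{-U}$, where $U:\mathbb{R}^d\to\mathbb{R}$ is twice continuously differentiable, $m$-strongly convex and $L$-smooth (i.e. $\nabla U$ is $L$-Lipschitz), with $m>0$. A multiproposal scheme with $K$ proposals is given by a Markov kernel $Q$ from $\mathbb{R}^d$ to $(\mathbb{R}^d)^K$ and a measurable function $h=(h_1,\dots,h_K)$ from $\mathbb{R}^d\times(\mathbb{R}^d)^K$ to $\{s\in[0,1]^K:\sum_i s_i\le 1\}$. Its transition kernel $P^{(K)}$ is as follows: from $x$, draw $(y_1,\dots,y_K)\sim Q(x,\cdot)$, then move to $y_i$ with probability $h_i(x,y_1,\dots,y_K)$, $i=1,\dots,K$, and stay at $x$ with probability $1-\sum_{i=1}^K h_i(x,y_1,\dots,y_K)$. For a $\pi$-reversible Markov kernel $P$, let $$\mathrm{Gap}(P)=\inf_{f\in L^2(\pi),\ \mathrm{Var}_\pi(f)>0}\frac{\int\int (f(y)-f(x))^2\,P(x,dy)\,\pi(dx)}{2\,\mathrm{Var}_\pi(f)}.$$ (1) Let $\sigma>0$, and consider any multiproposal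 scheme $(Q,h)$ with $K$ proposals such that $P^{(K)}$ is $\pi$-reversible and, for every $x$ and every $i$, the $i$-th marginal of $Q(x,\cdot)$ is $N(x,\sigma^2 I_d)$ (the dependence between the proposals and the function $h$ are otherwise arbitrary). Then $$\mathrm{Gap}(P^{(K)})\le 2\min\Bigl(\frac{K}{(1+m\sigma^2)^{d/2}},\ \sigma^2L\bigl(\tfrac12+\log K\bigr)\Bigr).$$ (2) Let $d,K>2$. For every $\sigma>0$ let $(Q_\sigma,h_\sigma)$ be a scheme as in (1) for this $\sigma$, with transition kernel $P^{(K)}_\sigma$. Then $$\sup_{\sigma>0}\mathrm{Gap}(P^{(K)}_\sigma)\le 4e^{1.04}\,\frac{L}{m}\,\frac{(\log K+\log d)^2}{d}.$$ -/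

import Mathlib

open MeasureTheory ProbabilityTheory
open scoped ENNReal

namespace MultiProposal

/-- A function `h : X × X ^ K → S_K = {s ∈ [0,1]^K : ∑ i, s i ≤ 1}`: `prob x y i` is the
probability of selecting the `i`-th proposed point `y i` as the next state when the current state
is `x` and the proposed points are `y`. -/
structure SelectionRule (X : Type*) [MeasurableSpace X] (K : ℕ) where
  prob : X → (Fin K → X) → Fin K → ℝ
  measurable_prob : ∀ i, Measurable fun p : X × (Fin K → X) => prob p.1 p.2 i
  prob_nonneg : ∀ x y i, 0 ≤ prob x y i
  sum_prob_le_one : ∀ x y, ∑ i, prob x y i ≤ 1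

/-- The selection step: given `(x, y)`, move to `y i` with probability `h_i (x, y)`, and stay at
`x` with the remaining probability `1 - ∑ i, h_i (x, y)`. -/
noncomputable def selectionKernel {X : Type*} [MeasurableSpace X] {K : ℕ}
    (h : SelectionRule X K) : Kernel (X × (Fin K → X)) X where
  toFun p := (∑ i, ENNReal.ofReal (h.prob p.1 p.2 i) • Measure.dirac (p.2 i))
    + ENNReal.ofReal (1 - ∑ i, h.prob p.1 p.2 i) • Measure.dirac p.1
  measurable' := by
    refine Measure.measurable_of_measurable_coe _ fun s hs => ?_
    have hm := h.measurable_prob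
    simp only [Measure.coe_add, Measure.coe_finsetSum, Measure.coe_smul, Pi.add_apply,
      Finset.sum_apply, Pi.smul_apply, smul_eq_mul, Measure.dirac_apply' _ hs]
    have h1 : Measurable (s.indicator (1 : X → ℝ≥0∞)) := measurable_one.indicator hs
    refine Measurable.add (Finset.measurable_sum _ fun i _ => ?_) ?_
    · exact (hm i).ennreal_ofReal.mul (h1.comp ((measurable_pi_apply i).comp measurable_snd))
    · exact (measurable_const.sub
        (Finset.measurable_sum _ fun i _ => hm i)).ennreal_ofReal.mul (h1.comp measurable_fst)

/-- The transition kernel `P^(K)` of the multiproposal algorithm with proposal kernel `Q` from `X`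
to `X ^ K` and selection rule `h`: from `x`, draw `y ∼ Q x`, then perform the selection step
at `(x, y)`. -/
noncomputable def mpKernel {X : Type*} [MeasurableSpace X] {K : ℕ}
    (Q : Kernel X (Fin K → X)) (h : SelectionRule X K) : Kernel X X :=
  selectionKernel h ∘ₖ (Kernel.id ×ₖ Q)

/-- Value of `P^(K) (x, A)` for `x ∉ A`. -/
lemma mpKernel_apply_of_notMem {X : Type*} [MeasurableSpace X] {K : ℕ}
    (Q : Kernel X (Fin K → X)) [IsMarkovKernel Q] (h : SelectionRule X K) {x : X} {A : Set X}
    (hA : MeasurableSet A) (hx : x ∉ A) :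
    mpKernel Q h x A = ∑ i, ∫⁻ y, A.indicator 1 (y i) * ENNReal.ofReal (h.prob x y i) ∂(Q x) := by
  have h1 : Measurable (A.indicator (1 : X → ℝ≥0∞)) := measurable_one.indicator hA
  rw [mpKernel, Kernel.comp_apply' _ _ _ hA, Kernel.prod_apply, Kernel.id_apply,
    lintegral_prod _ ((Kernel.measurable_coe _ hA).aemeasurable),
    lintegral_dirac' _ ((Kernel.measurable_coe _ hA).lintegral_prod_right'),
    ← lintegral_finsetSum]
  · refine lintegral_congr fun y => ?_
    simp [selectionKernel, Measure.dirac_apply' _ hA, hx, mul_comm]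
  · intro i _
    exact (h1.comp (measurable_pi_apply i)).mul
      ((h.measurable_prob i).comp measurable_prodMk_left).ennreal_ofReal

instance isMarkovKernel_selectionKernel {X : Type*} [MeasurableSpace X] {K : ℕ} (h : SelectionRule X K) :
    IsMarkovKernel (selectionKernel h) where
  isProbabilityMeasure p := ⟨by
    simp only [selectionKernel, Kernel.coe_mk, Measure.coe_add, Measure.coe_finsetSum,
      Measure.coe_smul, Pi.add_apply, Finset.sum_apply, Pi.smul_apply, smul_eq_mul,
      measure_univ, mul_one]
    rw [← ENNReal.ofReal_sum_of_nonneg fun i _ => h.prob_nonneg _ _ i,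
      ← ENNReal.ofReal_add (Finset.sum_nonneg fun i _ => h.prob_nonneg _ _ i)
        (sub_nonneg.2 (h.sum_prob_le_one _ _))]
    simp⟩

instance isMarkovKernel_mpKernel {X : Type*} [MeasurableSpace X] {K : ℕ}
    (Q : Kernel X (Fin K → X)) [IsMarkovKernel Q]
    (h : SelectionRule X K) : IsMarkovKernel (mpKernel Q h) := by
  unfold mpKernel; infer_instance

/-- The spectral gap of a `π`-reversible kernel `P`: the infimum of
`∫ (f y - f x)² π(dx) P(x, dy) / (2 Var_π f)` over the non-constant `f ∈ L²(π)`. -/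
noncomputable def spectralGap {X : Type*} [MeasurableSpace X] (P : Kernel X X) (π : Measure X) :
    ℝ≥0∞ :=
  ⨅ (f : X → ℝ) (_ : MemLp f 2 π) (_ : evariance f π ≠ 0),
    (∫⁻ x, ∫⁻ y, ENNReal.ofReal ((f y - f x) ^ 2) ∂(P x) ∂π) / (2 * evariance f π)

/-- The probability measure on `ℝ^d` with density proportional to `exp (-U)`. -/
noncomputable def target {d : ℕ} (U : EuclideanSpace ℝ (Fin d) → ℝ) :
    Measure (EuclideanSpace ℝ (Fin d)) :=
  volume.tilted fun x => -U x

/-- `U` is twice continuously differentiable, `m`-strongly convex and `L`-smooth. -/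
structure IsRegularPotential {d : ℕ} (U : EuclideanSpace ℝ (Fin d) → ℝ) (m L : ℝ) : Prop where
  contDiff : ContDiff ℝ 2 U
  strongConvexOn : StrongConvexOn Set.univ m U
  smooth : ∀ x y, ‖gradient U x - gradient U y‖ ≤ L * ‖x - y‖

/-- Each of the `K` marginals of `Q x` is the Gaussian distribution `N(x, σ² I)`. -/
def HasRandomWalkMarginals {d K : ℕ}
    (Q : Kernel (EuclideanSpace ℝ (Fin d)) (Fin K → EuclideanSpace ℝ (Fin d))) (σ : ℝ) : Prop :=
  ∀ x i, (Q x).map (fun y => y i) =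
    multivariateGaussian x (σ ^ 2 • (1 : Matrix (Fin d) (Fin d) ℝ))

/-- `Q`, `h` define a multiproposal scheme on `ℝ^d` reversible with respect to `target U`, with
`K` Gaussian random walk proposals of step size `σ`. -/
structure IsRandomWalkScheme {d K : ℕ} (U : EuclideanSpace ℝ (Fin d) → ℝ) (σ : ℝ)
    (Q : Kernel (EuclideanSpace ℝ (Fin d)) (Fin K → EuclideanSpace ℝ (Fin d)))
    (h : SelectionRule (EuclideanSpace ℝ (Fin d)) K) : Prop where
  isMarkovKernel : IsMarkovKernel Q
  marginals : HasRandomWalkMarginals Q σ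
  reversible : (mpKernel Q h).IsReversible (target U)

end MultiProposal

/-! Both upper bounds on the gap come from inserting one well-chosen test function, and neither
depends on the joint law of the proposals.

For the bound by `K / (1 + m σ²)^(d/2)`, test with the indicator of a small neighbourhood `A` of the
mode `c`. Since the chain can only move to a proposed point, a union bound gives `P(x, A) ≤ K · N(x,
σ²I)(A)` for `x ∉ A`. Strong convexity gives `e^{-U(x)} ≤ e^{-U(c)} e^{-m‖x-c‖²/2}`, and convolving
this profile with the Gaussian step yields at most `(1 + mσ²)^{-d/2}` per unit of volume of `A`. On
a small `A` the density is almost its maximum and `π(Aᶜ)` is close to 1, so all losses fit in the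
factor 2 (`spectralGap_mpKernel_le_mode`).

For the bound by `σ² L (1/2 + log K)`, test with a coordinate. Its variance is at least `1/L` by a
Cramér–Rao argument (`two_mul_sub_le_variance_coord`). Its squared displacement is at most that of
the farthest of `K` Gaussian proposals, whose mean is of order `σ² log K` by an exponential moment
bound (`lintegral_sq_mpKernel_le`).

For the supremum over `σ`, put `a = log K + log d`. The displacement bound is used when `mσ² ≤ 4a/d`
and the mode bound otherwise. If `d ≤ 2a²`, the claimed bound exceeds 2 and the trivial bound on the
gap is enough. -/

namespace MultiProposal

/-! ### Growth of the potential and integrability. -/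

section Potential

variable {d : ℕ} {U : EuclideanSpace ℝ (Fin d) → ℝ} {m L : ℝ}

/-- A continuous strongly convex function on a Euclidean space attains its minimum and grows at
least quadratically around it. -/
lemma exists_quadratic_growth (hm : 0 < m) (hc : Continuous U)
    (hU : StrongConvexOn Set.univ m U) :
    ∃ c, ∀ y, U c + m / 2 * ‖y - c‖ ^ 2 ≤ U y := by
  have key : ∀ x y : EuclideanSpace ℝ (Fin d), ∀ t : ℝ, 0 ≤ t → t ≤ 1 →
      U (x + t • (y - x)) ≤ (1 - t) * U x + t * U y - (1 - t) * t * (m / 2 * ‖y - x‖ ^ 2) := by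
    intro x y t h0 h1
    have := hU.2 (Set.mem_univ x) (Set.mem_univ y) (sub_nonneg.2 h1) h0 (by ring)
    simp only [smul_eq_mul] at this
    rw [norm_sub_rev x y] at this
    have e : x + t • (y - x) = (1 - t) • x + t • y := by module
    rw [e]; exact this
  obtain ⟨z, -, hz⟩ := (isCompact_closedBall (0 : EuclideanSpace ℝ (Fin d)) 1).exists_isMinOn
    ⟨0, by simp⟩ hc.continuousOn
  have hz' : ∀ u : EuclideanSpace ℝ (Fin d), ‖u‖ ≤ 1 → U z ≤ U u := fun u hu =>
    hz (by simpa using hu)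
  have hz0 := hz' 0 (by simp)
  -- Coercivity: on the segment from 0 to a far point `y`, strong convexity at the point of norm 1
  -- (weight `t = 1/‖y‖`), where `U` is at least `U z`, forces `U y ≥ U 0`.
  obtain ⟨c, hcmin⟩ := hc.exists_forall_le' (x₀ := 0) (by
    have h2 := (tendsto_norm_cocompact_atTop (E := EuclideanSpace ℝ (Fin d))).eventually_ge_atTop
      (1 + 2 * (U 0 - U z) / m)
    filter_upwards [h2] with y hy
    set r := ‖y‖
    have hr : 1 ≤ r := le_trans (by
      have : 0 ≤ 2 * (U 0 - U z) / m := by apply div_nonneg <;> linarith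
      linarith) hy
    have hr0 : 0 < r := by linarith
    have h3 := key 0 y r⁻¹ (by positivity) (inv_le_one_of_one_le₀ hr)
    have h4 := hz' (0 + r⁻¹ • (y - 0)) (by
      simp only [zero_add, sub_zero, norm_smul, norm_inv, Real.norm_eq_abs, abs_of_pos hr0]
      exact (inv_mul_cancel₀ hr0.ne').le)
    have h5 := h4.trans h3
    simp only [sub_zero] at h5
    have h6 : r * U z ≤ (r - 1) * U 0 + U y - (r - 1) * (m / 2 * r) := by
      have := mul_le_mul_of_nonneg_left h5 hr0.le
      calc r * U z ≤ _ := this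
        _ = _ := by field_simp; ring
    have h7 : 2 * (U 0 - U z) ≤ (r - 1) * m := by
      rw [← div_le_iff₀ hm]; linarith
    nlinarith)
  refine ⟨c, fun y => ?_⟩
  -- Minimality of `c` against `c + t(y - c)`, divided by `t`; letting `t → 0` recovers the full
  -- constant `m / 2`.
  have h1 : ∀ t : ℝ, 0 < t → t ≤ 1 → (1 - t) * (m / 2 * ‖y - c‖ ^ 2) ≤ U y - U c := by
    intro t h0 h1
    have h2 := (hcmin _).trans (key c y t h0.le h1)
    have h3 : t * ((1 - t) * (m / 2 * ‖y - c‖ ^ 2)) ≤ t * (U y - U c) := by linarith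
    exact le_of_mul_le_mul_left h3 h0
  have h2 : Filter.Tendsto (fun t : ℝ => (1 - t) * (m / 2 * ‖y - c‖ ^ 2))
      (nhdsWithin 0 (Set.Ioi 0)) (nhds ((1 - 0) * (m / 2 * ‖y - c‖ ^ 2))) :=
    Continuous.tendsto (by fun_prop) 0 |>.mono_left nhdsWithin_le_nhds
  have h3 := le_of_tendsto h2 (by
    filter_upwards [Ioc_mem_nhdsGT (zero_lt_one' ℝ)] with t ht using h1 t ht.1 ht.2)
  linarith

/-- Functions of at most quadratic growth are integrable against `exp (-U)`. -/
lemma integrable_mul_exp_neg (hm : 0 < m) (hc : Continuous U) {c : EuclideanSpace ℝ (Fin d)}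
    (hmin : ∀ y, U c + m / 2 * ‖y - c‖ ^ 2 ≤ U y)
    {f : EuclideanSpace ℝ (Fin d) → ℝ} (hf : Continuous f) {C : ℝ}
    (hfC : ∀ x, |f x| ≤ C * (1 + ‖x - c‖ ^ 2)) :
    Integrable (fun x => f x * Real.exp (-U x)) := by
  have hC : 0 ≤ C := by
    have := (abs_nonneg _).trans (hfC c)
    simpa using this
  have h0 : Integrable (fun x : EuclideanSpace ℝ (Fin d) => Real.exp (-(m / 4) * ‖x‖ ^ 2)) := by
    have := (GaussianFourier.integrable_cexp_neg_mul_sq_norm_add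
      (V := EuclideanSpace ℝ (Fin d)) (b := ((m / 4 : ℝ) : ℂ)) (by simpa using by linarith) 0 0).norm
    refine this.congr (Filter.Eventually.of_forall fun x => ?_)
    simp only [Complex.norm_exp]
    congr 1
    simp [← Complex.ofReal_pow]
  have h1 := (h0.comp_sub_right c).const_mul (C * Real.exp (-U c) * (1 + 4 / m))
  refine h1.mono' (by fun_prop) (Filter.Eventually.of_forall fun x => ?_)
  rw [norm_mul, Real.norm_eq_abs, Real.norm_eq_abs, Real.abs_exp]
  set r := ‖x - c‖ ^ 2
  have hr : 0 ≤ r := by positivity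
  -- The Gaussian factor is split in two halves: one absorbs the quadratic growth of `f`, the other
  -- stays integrable.
  have h2 : Real.exp (-U x) ≤ Real.exp (-U c) * (Real.exp (-(m / 4) * r) * Real.exp (-(m / 4) * r)) := by
    rw [← Real.exp_add, ← Real.exp_add]
    apply Real.exp_le_exp.2
    have := hmin x
    linarith
  have h3 : (1 + r) * Real.exp (-(m / 4) * r) ≤ 1 + 4 / m := by
    have e1 : Real.exp (-(m / 4) * r) ≤ 1 := Real.exp_le_one_iff.2 (by
      have := mul_nonneg hm.le hr; linarith)
    have e2 : m / 4 * r * Real.exp (-(m / 4) * r) ≤ 1 := by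
      have := Real.add_one_le_exp (m / 4 * r)
      have h' : Real.exp (m / 4 * r) * Real.exp (-(m / 4) * r) = 1 := by
        rw [← Real.exp_add]; simp
      nlinarith [Real.exp_pos (-(m / 4) * r)]
    have e3 : r * Real.exp (-(m / 4) * r) ≤ 4 / m := by
      rw [le_div_iff₀ hm]; linarith
    linarith
  calc |f x| * Real.exp (-U x)
      ≤ C * (1 + r) * (Real.exp (-U c) * (Real.exp (-(m / 4) * r) * Real.exp (-(m / 4) * r))) := by
        gcongr
        exact hfC x
    _ = C * Real.exp (-U c) * ((1 + r) * Real.exp (-(m / 4) * r)) * Real.exp (-(m / 4) * r) := by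
        ring
    _ ≤ _ := by gcongr

lemma integrable_exp_neg (hm : 0 < m) (hc : Continuous U) {c : EuclideanSpace ℝ (Fin d)}
    (hmin : ∀ y, U c + m / 2 * ‖y - c‖ ^ 2 ≤ U y) :
    Integrable (fun x => Real.exp (-U x)) := by
  have := integrable_mul_exp_neg hm hc hmin (f := fun _ => 1) continuous_const (C := 1)
    (fun x => by simp)
  simpa using this

end Potential

end MultiProposal

namespace MultiProposal

/-! ### Gaussian integrals. -/

section Gaussian

open scoped MatrixOrder Matrix.Norms.L2Operator in
lemma multivariateGaussian_smul_one {d : ℕ} (x : EuclideanSpace ℝ (Fin d)) {σ : ℝ} (hσ : 0 < σ) :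
    multivariateGaussian x (σ ^ 2 • (1 : Matrix (Fin d) (Fin d) ℝ)) =
      (stdGaussian (EuclideanSpace ℝ (Fin d))).map (fun z => x + σ • z) := by
  have h : CFC.sqrt (σ ^ 2 • (1 : Matrix (Fin d) (Fin d) ℝ)) = σ • 1 := by
    apply CFC.sqrt_unique
    · rw [smul_mul_smul_comm, mul_one, sq]
    · exact smul_nonneg hσ.le zero_le_one
  rw [multivariateGaussian, h]
  congr 1
  ext z
  simp

/-- Integral of a Gaussian function against the standard Gaussian measure on the line. -/
lemma integral_exp_sq_gaussianReal_le {m : ℝ} (hm : 0 < m) (a s : ℝ) :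
    Integrable (fun z => Real.exp (-(m / 2) * (a + s * z) ^ 2)) (gaussianReal 0 1) ∧
    ∫ z, Real.exp (-(m / 2) * (a + s * z) ^ 2) ∂(gaussianReal 0 1) ≤
      (Real.sqrt (1 + m * s ^ 2))⁻¹ := by
  constructor
  · refine Integrable.mono' (integrable_const (1 : ℝ)) (by fun_prop)
      (Filter.Eventually.of_forall fun z => ?_)
    rw [Real.norm_eq_abs, Real.abs_exp, Real.exp_le_one_iff]
    nlinarith [sq_nonneg (a + s * z)]
  set b := 1 + m * s ^ 2 with hb
  have hb0 : 0 < b := by positivity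
  rw [integral_gaussianReal_eq_integral_smul one_ne_zero]
  have hint : Integrable (fun z : ℝ => (Real.sqrt (2 * Real.pi))⁻¹ *
      Real.exp (-(b / 2) * (z + m * s * a / b) ^ 2)) :=
    ((integrable_exp_neg_mul_sq (half_pos hb0)).comp_add_right (m * s * a / b)).const_mul _
  -- Complete the square in `z`; the leftover factor `exp(-m a² / (2b))` is at most 1 and is
  -- dropped, which makes the bound uniform in `a`.
  calc _ ≤ ∫ z : ℝ, (Real.sqrt (2 * Real.pi))⁻¹ *
          Real.exp (-(b / 2) * (z + m * s * a / b) ^ 2) := by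
        refine integral_mono_of_nonneg (Filter.Eventually.of_forall fun z => ?_) hint
          (Filter.Eventually.of_forall fun z => ?_)
        · exact mul_nonneg (gaussianPDFReal_nonneg _ _ _) (Real.exp_pos _).le
        · simp only [gaussianPDFReal, smul_eq_mul, NNReal.coe_one, mul_one, sub_zero]
          rw [mul_assoc, ← Real.exp_add]
          gcongr
          have : -(b / 2) * (z + m * s * a / b) ^ 2 - (-z ^ 2 / 2 + -(m / 2) * (a + s * z) ^ 2)
              = m / 2 * a ^ 2 / b := by
            field_simp
            rw [hb]; ring
          have h2 : 0 ≤ m / 2 * a ^ 2 / b := by positivity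
          linarith
    _ = (Real.sqrt b)⁻¹ := by
        rw [integral_const_mul,
          integral_add_right_eq_self (fun z : ℝ => Real.exp (-(b / 2) * z ^ 2)),
          integral_gaussian, ← Real.sqrt_inv, ← Real.sqrt_inv, ← Real.sqrt_mul (by positivity)]
        congr 1
        field_simp

lemma lintegral_exp_neg_stdGaussian_le {d : ℕ} {m : ℝ} (hm : 0 < m)
    (a : EuclideanSpace ℝ (Fin d)) (s : ℝ) :
    ∫⁻ z, ENNReal.ofReal (Real.exp (-(m / 2) * ‖a + s • z‖ ^ 2))
        ∂(stdGaussian (EuclideanSpace ℝ (Fin d))) ≤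
      ENNReal.ofReal (((1 + m * s ^ 2) ^ ((d : ℝ) / 2))⁻¹) := by
  have hint : Integrable (fun z : Fin d → ℝ =>
      ∏ i, Real.exp (-(m / 2) * (a i + s * z i) ^ 2)) (Measure.pi fun _ => gaussianReal 0 1) :=
    Integrable.fintype_prod fun i => (integral_exp_sq_gaussianReal_le hm (a i) s).1
  rw [← map_pi_eq_stdGaussian, lintegral_map (by fun_prop) (by fun_prop)]
  have e : ∀ z : Fin d → ℝ, Real.exp (-(m / 2) * ‖a + s • WithLp.toLp 2 z‖ ^ 2) =
      ∏ i, Real.exp (-(m / 2) * (a i + s * z i) ^ 2) := by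
    intro z
    rw [← Real.exp_sum, EuclideanSpace.norm_sq_eq, Finset.mul_sum]
    simp
  simp_rw [e]
  rw [← ofReal_integral_eq_lintegral_ofReal hint
    (Filter.Eventually.of_forall fun z => Finset.prod_nonneg fun i _ => (Real.exp_pos _).le)]
  apply ENNReal.ofReal_le_ofReal
  rw [integral_fintype_prod_eq_prod (f := fun i z => Real.exp (-(m / 2) * (a i + s * z) ^ 2))]
  calc _ ≤ ∏ _i : Fin d, (Real.sqrt (1 + m * s ^ 2))⁻¹ :=
        Finset.prod_le_prod (fun i _ => integral_nonneg fun z => (Real.exp_pos _).le)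
          fun i _ => (integral_exp_sq_gaussianReal_le hm (a i) s).2
    _ = _ := by
        rw [Finset.prod_const, Finset.card_univ, Fintype.card_fin, inv_pow, Real.sqrt_eq_rpow,
          ← Real.rpow_natCast, ← Real.rpow_mul (by positivity)]
        ring_nf

/-- Chi-square moment generating function at `1/4`, namely `(1 - 2/4)^(-1/2)`. It feeds the bound on
the maximum of `K` squared Gaussians. -/
lemma integral_exp_sq_div_four_gaussianReal :
    Integrable (fun z => Real.exp (z ^ 2 / 4)) (gaussianReal 0 1) ∧
    ∫ z, Real.exp (z ^ 2 / 4) ∂(gaussianReal 0 1) = Real.sqrt 2 := by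
  have e : ∀ z : ℝ, gaussianPDFReal 0 1 z * Real.exp (z ^ 2 / 4) =
      (Real.sqrt (2 * Real.pi))⁻¹ * Real.exp (-(1 / 4) * z ^ 2) := by
    intro z
    simp only [gaussianPDFReal, NNReal.coe_one, mul_one, sub_zero]
    rw [mul_assoc, ← Real.exp_add]
    congr 2
    ring
  constructor
  · rw [gaussianReal_of_var_ne_zero _ one_ne_zero,
      integrable_withDensity_iff (by fun_prop) (Filter.Eventually.of_forall fun z => by
        simp [gaussianPDF])]
    have : Integrable (fun z : ℝ => (Real.sqrt (2 * Real.pi))⁻¹ * Real.exp (-(1 / 4) * z ^ 2)) :=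
      (integrable_exp_neg_mul_sq (by norm_num)).const_mul _
    refine this.congr (Filter.Eventually.of_forall fun z => ?_)
    simp only [toReal_gaussianPDF]
    rw [mul_comm (Real.exp _), e]
  · rw [integral_gaussianReal_eq_integral_smul one_ne_zero]
    simp_rw [smul_eq_mul, e]
    rw [integral_const_mul, integral_gaussian, ← Real.sqrt_inv, ← Real.sqrt_mul (by positivity)]
    congr 1
    field_simp
    norm_num

/-- The coordinates of a Gaussian random walk step. -/
lemma map_coord_multivariateGaussian {d : ℕ} (x : EuclideanSpace ℝ (Fin d)) {σ : ℝ} (hσ : 0 < σ)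
    (j : Fin d) :
    (multivariateGaussian x (σ ^ 2 • (1 : Matrix (Fin d) (Fin d) ℝ))).map
      (fun y => (y j - x j) / σ) = gaussianReal 0 1 := by
  rw [multivariateGaussian_smul_one x hσ, ← map_pi_eq_stdGaussian,
    Measure.map_map (by fun_prop) (by fun_prop), Measure.map_map (by fun_prop) (by fun_prop)]
  have : (((fun y : EuclideanSpace ℝ (Fin d) => (y j - x j) / σ) ∘ fun z => x + σ • z) ∘
      WithLp.toLp 2) = Function.eval j := by
    ext z
    simp [hσ.ne']
  rw [this, (measurePreserving_eval (fun _ : Fin d => gaussianReal 0 1) j).map_eq]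

end Gaussian

end MultiProposal

namespace MultiProposal

/-! ### Indicator test functions and conductance. -/

section Conductance

variable {X : Type*} [MeasurableSpace X]

lemma memLp_indicator_one {π : Measure X} [IsProbabilityMeasure π] {A : Set X}
    (hA : MeasurableSet A) : MemLp (A.indicator fun _ => (1 : ℝ)) 2 π :=
  memLp_indicator_const 2 hA 1 (Or.inr (measure_ne_top _ _))

lemma evariance_indicator {π : Measure X} [IsProbabilityMeasure π] {A : Set X}
    (hA : MeasurableSet A) : evariance (A.indicator fun _ => (1 : ℝ)) π = π A * π Aᶜ := by
  have h := memLp_indicator_one (π := π) hA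
  have hsq : (A.indicator fun _ => (1 : ℝ)) ^ 2 = A.indicator fun _ => (1 : ℝ) := by
    ext x
    by_cases hx : x ∈ A <;> simp [hx]
  rw [← h.ofReal_variance_eq, variance_eq_sub h, hsq, integral_indicator_const _ hA, smul_eq_mul,
    mul_one, ← ofReal_measureReal (μ := π) (s := A), ← ofReal_measureReal (μ := π) (s := Aᶜ),
    ← ENNReal.ofReal_mul measureReal_nonneg, probReal_compl_eq_one_sub hA]
  congr 1
  ring

/-- The spectral gap is bounded by the conductance of any set. -/
lemma spectralGap_le_flow_div {P : Kernel X X} {π : Measure X} [IsProbabilityMeasure π]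
    (hrev : P.IsReversible π) {A : Set X} (hA : MeasurableSet A) (h0 : π A ≠ 0) (h1 : π Aᶜ ≠ 0) :
    spectralGap P π ≤ (∫⁻ x in Aᶜ, P x A ∂π) / (π A * π Aᶜ) := by
  have hev := evariance_indicator (π := π) hA
  refine iInf_le_of_le (A.indicator fun _ => 1) (iInf_le_of_le (memLp_indicator_one hA)
    (iInf_le_of_le (by rw [hev]; exact mul_ne_zero h0 h1) ?_))
  have hnum : ∫⁻ x, ∫⁻ y, ENNReal.ofReal ((A.indicator (fun _ => (1 : ℝ)) y -
      A.indicator (fun _ => (1 : ℝ)) x) ^ 2) ∂(P x) ∂π = 2 * ∫⁻ x in Aᶜ, P x A ∂π := by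
    rw [← lintegral_add_compl _ hA, two_mul]
    congr 1
    -- Reversibility makes the flows across `A` in the two directions equal, so the Dirichlet form
    -- of the indicator is twice one flow.
    · rw [← hrev hA hA.compl]
      refine setLIntegral_congr_fun hA fun x hx => ?_
      rw [← lintegral_indicator_one hA.compl]
      refine lintegral_congr fun y => ?_
      by_cases hy : y ∈ A <;> simp [hx, hy]
    · refine setLIntegral_congr_fun hA.compl fun x hx => ?_
      have hx' : x ∉ A := hx
      rw [← lintegral_indicator_one hA]
      refine lintegral_congr fun y => ?_
      by_cases hy : y ∈ A <;> simp [hx', hy]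
  rw [hnum, hev, ENNReal.mul_div_mul_left _ _ two_ne_zero ENNReal.ofNat_ne_top]

/-- The flow out of `A` is at most `π A`, so the gap is at most `1 / π Aᶜ`. -/
lemma spectralGap_le_two {P : Kernel X X} [IsMarkovKernel P] {π : Measure X}
    [IsProbabilityMeasure π] (hrev : P.IsReversible π) {A : Set X} (hA : MeasurableSet A)
    (h0 : π A ≠ 0) (h1 : 2⁻¹ ≤ π Aᶜ) : spectralGap P π ≤ 2 := by
  have h1' : π Aᶜ ≠ 0 := fun h => by simp [h] at h1
  refine (spectralGap_le_flow_div hrev hA h0 h1').trans ?_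
  have hflow : ∫⁻ x in Aᶜ, P x A ∂π ≤ π A := by
    rw [← hrev hA hA.compl]
    calc _ ≤ ∫⁻ _ in A, 1 ∂π := lintegral_mono fun x => prob_le_one
      _ = _ := by simp
  refine ENNReal.div_le_of_le_mul ?_
  calc _ ≤ π A := hflow
    _ = 2 * (π A * 2⁻¹) := by
      rw [mul_comm, mul_assoc, ENNReal.inv_mul_cancel two_ne_zero ENNReal.ofNat_ne_top, mul_one]
    _ ≤ _ := by gcongr

end Conductance

/-! ### The bound from a neighbourhood of the mode. -/

section Ball

variable {d K : ℕ} {U : EuclideanSpace ℝ (Fin d) → ℝ} {m : ℝ}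

/-- Outside a set `A`, the multiproposal kernel enters `A` with probability at most `K` times
the probability of a single proposal. -/
lemma mpKernel_le_mul_gaussian {σ : ℝ} (hσ : 0 < σ)
    {Q : Kernel (EuclideanSpace ℝ (Fin d)) (Fin K → EuclideanSpace ℝ (Fin d))} [IsMarkovKernel Q]
    (h : SelectionRule (EuclideanSpace ℝ (Fin d)) K) (hQ : HasRandomWalkMarginals Q σ)
    {x : EuclideanSpace ℝ (Fin d)} {A : Set (EuclideanSpace ℝ (Fin d))} (hA : MeasurableSet A)
    (hx : x ∉ A) :
    mpKernel Q h x A ≤ K * ∫⁻ z, A.indicator 1 (x + σ • z)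
      ∂(stdGaussian (EuclideanSpace ℝ (Fin d))) := by
  have h1 : Measurable (A.indicator (1 : EuclideanSpace ℝ (Fin d) → ℝ≥0∞)) :=
    measurable_one.indicator hA
  rw [mpKernel_apply_of_notMem Q h hA hx]
  calc _ ≤ ∑ _i : Fin K, ∫⁻ z, A.indicator 1 (x + σ • z)
        ∂(stdGaussian (EuclideanSpace ℝ (Fin d))) := by
        refine Finset.sum_le_sum fun i _ => ?_
        rw [← lintegral_map (f := A.indicator 1) (g := fun z => x + σ • z) h1 (by fun_prop),
          ← multivariateGaussian_smul_one x hσ, ← hQ x i,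
          lintegral_map h1 (measurable_pi_apply i)]
        refine lintegral_mono fun y => ?_
        have : h.prob x y i ≤ 1 :=
          (Finset.single_le_sum (fun j _ => h.prob_nonneg x y j) (Finset.mem_univ i)).trans
            (h.sum_prob_le_one x y)
        exact mul_le_of_le_one_right' (ENNReal.ofReal_le_one.2 this)
    _ = _ := by simp

/-- The mass that a Gaussian profile sends into `A` in one Gaussian step. -/
lemma lintegral_exp_mul_gaussian_le (hm : 0 < m) (c : EuclideanSpace ℝ (Fin d)) (σ : ℝ)
    {A : Set (EuclideanSpace ℝ (Fin d))} (hA : MeasurableSet A) :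
    ∫⁻ x, ENNReal.ofReal (Real.exp (-(m / 2) * ‖x - c‖ ^ 2)) *
        ∫⁻ z, A.indicator 1 (x + σ • z) ∂(stdGaussian (EuclideanSpace ℝ (Fin d))) ≤
      ENNReal.ofReal (((1 + m * σ ^ 2) ^ ((d : ℝ) / 2))⁻¹) * volume A := by
  have h1 : Measurable (A.indicator (1 : EuclideanSpace ℝ (Fin d) → ℝ≥0∞)) :=
    measurable_one.indicator hA
  set γ := stdGaussian (EuclideanSpace ℝ (Fin d))
  set φ : EuclideanSpace ℝ (Fin d) → ℝ≥0∞ := fun x =>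
    ENNReal.ofReal (Real.exp (-(m / 2) * ‖x - c‖ ^ 2)) with hφ
  have hφm : Measurable φ := by fun_prop
  have hm1 : Measurable fun p : EuclideanSpace ℝ (Fin d) × EuclideanSpace ℝ (Fin d) =>
      φ p.1 * A.indicator 1 (p.1 + σ • p.2) :=
    (hφm.comp measurable_fst).mul (h1.comp (by fun_prop))
  have hm2 : Measurable fun p : EuclideanSpace ℝ (Fin d) × EuclideanSpace ℝ (Fin d) =>
      φ (p.2 - σ • p.1) * A.indicator 1 p.2 :=
    (hφm.comp (by fun_prop)).mul (h1.comp measurable_snd)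
  -- Swap the integrals and translate `x` by `σ z`: the indicator no longer depends on `z`, and the
  -- average of the profile over `z` is bounded uniformly in `x`. The shift has step `-σ`, but the
  -- bound is even in `σ`.
  calc _ = ∫⁻ x, ∫⁻ z, φ x * A.indicator 1 (x + σ • z) ∂γ := by
        refine lintegral_congr fun x => ?_
        exact (lintegral_const_mul _ (h1.comp (g := A.indicator 1) (f := fun z => x + σ • z)
          (by fun_prop))).symm
    _ = ∫⁻ z, ∫⁻ x, φ x * A.indicator 1 (x + σ • z) ∂volume ∂γ :=
        lintegral_lintegral_swap hm1.aemeasurable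
    _ = ∫⁻ z, ∫⁻ x, φ (x - σ • z) * A.indicator 1 x ∂volume ∂γ := by
        refine lintegral_congr fun z => ?_
        rw [← lintegral_add_right_eq_self (fun x => φ (x - σ • z) * A.indicator 1 x) (σ • z)]
        simp
    _ = ∫⁻ x, ∫⁻ z, φ (x - σ • z) * A.indicator 1 x ∂γ :=
        lintegral_lintegral_swap hm2.aemeasurable
    _ ≤ ∫⁻ x, ENNReal.ofReal (((1 + m * σ ^ 2) ^ ((d : ℝ) / 2))⁻¹) * A.indicator 1 x := by
        refine lintegral_mono fun x => ?_
        simp only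
        rw [lintegral_mul_const _ (f := fun z => φ (x - σ • z)) (hφm.comp (by fun_prop))]
        gcongr
        have := lintegral_exp_neg_stdGaussian_le hm (x - c) (-σ)
        rw [neg_sq] at this
        refine le_trans (le_of_eq (lintegral_congr fun z => ?_)) this
        simp only [hφ]
        congr 5
        module
    _ = _ := by rw [lintegral_const_mul _ h1, lintegral_indicator_one hA]

/-- Small neighbourhoods of the mode: the density is almost constant, the mass is small. -/
lemma exists_small_neighbourhood (hd : 1 ≤ d) (hc : Continuous U)
    (hi : Integrable fun x => Real.exp (-U x)) (c : EuclideanSpace ℝ (Fin d)) :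
    ∃ A, MeasurableSet A ∧ target U A ≠ 0 ∧ 3 / 4 ≤ target U Aᶜ ∧
      ENNReal.ofReal (Real.exp (-U c) / ∫ x, Real.exp (-U x)) * volume A ≤
        ENNReal.ofReal (3 / 2) * target U A := by
  have : Nonempty (Fin d) := ⟨⟨0, hd⟩⟩
  have hprob : IsProbabilityMeasure (target U) := isProbabilityMeasure_tilted hi
  set Z := ∫ x, Real.exp (-U x) with hZ
  have hZ0 : 0 < Z := integral_exp_pos hi
  have hsing : target U {c} = 0 :=
    tilted_absolutelyContinuous volume (fun x => -U x) (by simp)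
  -- `V` controls the mass of `A`; the sublevel set below makes the density on `A` at least `2/3` of
  -- its value at `c`. The constants are chosen so that `(3/2) / (3/4) = 2`.
  obtain ⟨V, hcV, hVo, hV⟩ := Set.exists_isOpen_lt_of_lt {c} (μ := target U) (1 / 4)
    (by rw [hsing]; simp)
  have hlog : 0 < Real.log (3 / 2) := Real.log_pos (by norm_num)
  have hWo : IsOpen {x | U x < U c + Real.log (3 / 2)} := isOpen_lt hc continuous_const
  set A := V ∩ {x | U x < U c + Real.log (3 / 2)} with hAdef
  have hAo : IsOpen A := hVo.inter hWo
  have hcA : c ∈ A := ⟨hcV rfl, by simpa using hlog⟩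
  have hvol : 0 < volume A := hAo.measure_pos volume ⟨c, hcA⟩
  have hle : ENNReal.ofReal (Real.exp (-U c) / Z) * volume A ≤
      ENNReal.ofReal (3 / 2) * target U A := by
    rw [target, tilted_apply _ _ A, ← lintegral_const_mul' _ _ ENNReal.ofReal_ne_top,
      ← setLIntegral_const]
    refine setLIntegral_mono' hAo.measurableSet fun x hx => ?_
    rw [← ENNReal.ofReal_mul (by norm_num)]
    apply ENNReal.ofReal_le_ofReal
    rw [← mul_div_assoc]
    apply div_le_div_of_nonneg_right _ hZ0.le
    have hx2 : U x < U c + Real.log (3 / 2) := hx.2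
    calc Real.exp (-U c) ≤ Real.exp (Real.log (3 / 2) + -U x) :=
          Real.exp_le_exp.2 (by linarith)
      _ = _ := by rw [Real.exp_add, Real.exp_log (by norm_num)]
  refine ⟨A, hAo.measurableSet, fun h0 => ?_, ?_, hle⟩
  · rw [h0, mul_zero, nonpos_iff_eq_zero, mul_eq_zero, ENNReal.ofReal_eq_zero] at hle
    rcases hle with h | h
    · exact absurd h (not_le.2 (by positivity))
    · exact hvol.ne' h
  · have hA4 : target U A ≤ 1 / 4 := (measure_mono Set.inter_subset_left).trans hV.le
    rw [prob_compl_eq_one_sub hAo.measurableSet]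
    refine le_trans ?_ (tsub_le_tsub_left hA4 1)
    refine ENNReal.le_sub_of_add_le_right (by simp) ?_
    rw [← ENNReal.toReal_le_toReal (by finiteness) (by finiteness),
      ENNReal.toReal_add (by finiteness) (by finiteness)]
    norm_num

lemma spectralGap_mpKernel_le_two (hd : 1 ≤ d) (hc : Continuous U)
    (hi : Integrable fun x => Real.exp (-U x))
    {Q : Kernel (EuclideanSpace ℝ (Fin d)) (Fin K → EuclideanSpace ℝ (Fin d))} [IsMarkovKernel Q]
    {h : SelectionRule (EuclideanSpace ℝ (Fin d)) K}
    (hrev : (mpKernel Q h).IsReversible (target U)) :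
    spectralGap (mpKernel Q h) (target U) ≤ 2 := by
  have hprob : IsProbabilityMeasure (target U) := isProbabilityMeasure_tilted hi
  obtain ⟨A, hA, h0, h1, -⟩ := exists_small_neighbourhood hd hc hi 0
  refine spectralGap_le_two hrev hA h0 (le_trans ?_ h1)
  rw [← ENNReal.toReal_le_toReal (by finiteness) (by finiteness)]
  norm_num

/-- The spectral gap is limited by the acceptance rate at the mode. -/
lemma spectralGap_mpKernel_le_mode (hd : 1 ≤ d) (hm : 0 < m) (hc : Continuous U)
    {c : EuclideanSpace ℝ (Fin d)} (hmin : ∀ y, U c + m / 2 * ‖y - c‖ ^ 2 ≤ U y)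
    {σ : ℝ} (hσ : 0 < σ)
    {Q : Kernel (EuclideanSpace ℝ (Fin d)) (Fin K → EuclideanSpace ℝ (Fin d))} [IsMarkovKernel Q]
    {h : SelectionRule (EuclideanSpace ℝ (Fin d)) K} (hQ : HasRandomWalkMarginals Q σ)
    (hrev : (mpKernel Q h).IsReversible (target U)) :
    spectralGap (mpKernel Q h) (target U) ≤
      ENNReal.ofReal (2 * ((K : ℝ) / (1 + m * σ ^ 2) ^ ((d : ℝ) / 2))) := by
  have hi := integrable_exp_neg hm hc hmin
  have hprob : IsProbabilityMeasure (target U) := isProbabilityMeasure_tilted hi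
  set Z := ∫ x, Real.exp (-U x) with hZ
  have hZ0 : 0 < Z := integral_exp_pos hi
  obtain ⟨A, hA, h0, h1, h2⟩ := exists_small_neighbourhood hd hc hi c
  have h1' : target U Aᶜ ≠ 0 := fun h => by simp [h] at h1
  refine (spectralGap_le_flow_div hrev hA h0 h1').trans ?_
  set γ := stdGaussian (EuclideanSpace ℝ (Fin d))
  set ρ := ((1 + m * σ ^ 2) ^ ((d : ℝ) / 2))⁻¹ with hρ
  have hρ0 : 0 ≤ ρ := by positivity
  have hflow : ∫⁻ x in Aᶜ, mpKernel Q h x A ∂(target U) ≤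
      K * ENNReal.ofReal ρ * (ENNReal.ofReal (Real.exp (-U c) / Z) * volume A) := by
    calc _ ≤ ∫⁻ x in Aᶜ, K * ∫⁻ z, A.indicator 1 (x + σ • z) ∂γ ∂(target U) :=
          setLIntegral_mono' hA.compl fun x hx => mpKernel_le_mul_gaussian hσ h hQ hA hx
      _ ≤ ∫⁻ x, K * ∫⁻ z, A.indicator 1 (x + σ • z) ∂γ ∂(target U) := setLIntegral_le_lintegral _ _
      _ = K * ∫⁻ x, ∫⁻ z, A.indicator 1 (x + σ • z) ∂γ ∂(target U) :=
          lintegral_const_mul' _ _ (by simp)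
      _ ≤ K * (ENNReal.ofReal (Real.exp (-U c) / Z) *
            (∫⁻ x, ENNReal.ofReal (Real.exp (-(m / 2) * ‖x - c‖ ^ 2)) *
              ∫⁻ z, A.indicator 1 (x + σ • z) ∂γ)) := by
          gcongr
          rw [target, lintegral_tilted, ← lintegral_const_mul' _ _ ENNReal.ofReal_ne_top]
          refine lintegral_mono fun x => ?_
          rw [← mul_assoc, ← ENNReal.ofReal_mul (by positivity)]
          gcongr
          rw [div_mul_eq_mul_div, ← Real.exp_add]
          gcongr
          have := hmin x
          linarith
      _ ≤ K * (ENNReal.ofReal (Real.exp (-U c) / Z) * (ENNReal.ofReal ρ * volume A)) := by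
          gcongr
          exact lintegral_exp_mul_gaussian_le hm c σ hA
      _ = _ := by ring
  refine ENNReal.div_le_of_le_mul ?_
  calc _ ≤ K * ENNReal.ofReal ρ * (ENNReal.ofReal (3 / 2) * target U A) :=
        hflow.trans (by gcongr)
    _ = ENNReal.ofReal (2 * ((K : ℝ) * ρ)) * (target U A * ENNReal.ofReal (3 / 4)) := by
        have e : ENNReal.ofReal (2 * ((K : ℝ) * ρ)) = 2 * (K * ENNReal.ofReal ρ) := by
          rw [ENNReal.ofReal_mul (by norm_num), ENNReal.ofReal_mul (by positivity)]
          simp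
        have e2 : ENNReal.ofReal (3 / 2) = 2 * ENNReal.ofReal (3 / 4) := by
          rw [← ENNReal.ofReal_ofNat 2, ← ENNReal.ofReal_mul (by norm_num)]
          norm_num
        rw [e, e2]
        ring
    _ ≤ _ := by
        rw [div_eq_mul_inv (K : ℝ), ← hρ]
        gcongr
        refine le_trans (le_of_eq ?_) h1
        rw [ENNReal.ofReal_div_of_pos (by norm_num)]
        simp

end Ball

end MultiProposal

namespace MultiProposal

/-! ### A Cramér–Rao lower bound on the variance of a coordinate. -/

section CramerRao

variable {d : ℕ} {U : EuclideanSpace ℝ (Fin d) → ℝ} {m L : ℝ}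

lemma norm_fderiv_sub_le (hU : IsRegularPotential U m L) (x y : EuclideanSpace ℝ (Fin d)) :
    ‖fderiv ℝ U x - fderiv ℝ U y‖ ≤ L * ‖x - y‖ := by
  have h := hU.smooth x y
  rwa [gradient, gradient, ← map_sub, LinearIsometryEquiv.norm_map] at h

lemma fderiv_minimizer_eq_zero (hm : 0 < m) {c : EuclideanSpace ℝ (Fin d)}
    (hmin : ∀ y, U c + m / 2 * ‖y - c‖ ^ 2 ≤ U y) : fderiv ℝ U c = 0 :=
  IsLocalMin.fderiv_eq_zero (Filter.Eventually.of_forall fun y => by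
    have := hmin y
    have h2 : 0 ≤ m / 2 * ‖y - c‖ ^ 2 := by positivity
    linarith)

/-- The strong convexity constant is at most twice the smoothness constant. -/
lemma strongConvexity_le_two_mul_smoothness (hd : 1 ≤ d) (hm : 0 < m)
    (hU : IsRegularPotential U m L) {c : EuclideanSpace ℝ (Fin d)}
    (hmin : ∀ y, U c + m / 2 * ‖y - c‖ ^ 2 ≤ U y) : m ≤ 2 * L := by
  set e : EuclideanSpace ℝ (Fin d) := EuclideanSpace.single ⟨0, hd⟩ 1
  have he : ‖e‖ = 1 := by simp [e]
  have h0 := fderiv_minimizer_eq_zero hm hmin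
  have hL : 0 ≤ L := by
    have := (norm_nonneg _).trans (norm_fderiv_sub_le hU (c + e) c)
    simpa [he] using this
  -- On the unit ball around `c` the derivative has norm at most `L`, so `U` rises by at most `L`
  -- along a unit vector, while quadratic growth makes it rise by at least `m / 2`.
  have h1 := (convex_closedBall c (1 : ℝ)).norm_image_sub_le_of_norm_fderiv_le (𝕜 := ℝ) (f := U)
    (C := L) (x := c) (y := c + e) (fun x _ => hU.contDiff.differentiable (by norm_num) x)
    (fun x hx => by
      have := norm_fderiv_sub_le hU x c
      rw [h0, sub_zero] at this
      refine this.trans (mul_le_of_le_one_right hL ?_)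
      simpa [dist_eq_norm] using hx) (by simp) (by simp [he])
  have h2 := hmin (c + e)
  simp only [add_sub_cancel_left, he] at h1 h2
  have := (le_abs_self _).trans h1
  linarith

/-- Integration by parts against the density `exp (-U)`. -/
lemma integral_fderiv_mul_exp_neg (hm : 0 < m) (hU : IsRegularPotential U m L)
    {c : EuclideanSpace ℝ (Fin d)} (hmin : ∀ y, U c + m / 2 * ‖y - c‖ ^ 2 ≤ U y)
    (v : EuclideanSpace ℝ (Fin d)) {f : EuclideanSpace ℝ (Fin d) → ℝ} (hf : ContDiff ℝ 1 f)
    {C C₁ C₂ : ℝ} (hfC : ∀ x, |f x| ≤ C * (1 + ‖x - c‖ ^ 2))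
    (hfC₁ : ∀ x, |fderiv ℝ f x v| ≤ C₁ * (1 + ‖x - c‖ ^ 2))
    (hfC₂ : ∀ x, |f x * fderiv ℝ U x v| ≤ C₂ * (1 + ‖x - c‖ ^ 2)) :
    ∫ x, f x * fderiv ℝ U x v * Real.exp (-U x) = ∫ x, fderiv ℝ f x v * Real.exp (-U x) := by
  have hUd : Differentiable ℝ U := hU.contDiff.differentiable (by norm_num)
  have hUf : Continuous (fderiv ℝ U) := hU.contDiff.continuous_fderiv (by norm_num)
  have hfd : Continuous (fderiv ℝ f) := hf.continuous_fderiv (by norm_num)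
  have hder : ∀ x, fderiv ℝ (fun x => Real.exp (-U x)) x v =
      -(fderiv ℝ U x v * Real.exp (-U x)) := by
    intro x
    have hd : HasFDerivAt (fun x => Real.exp (-U x)) (Real.exp (-U x) • -fderiv ℝ U x) x :=
      (hUd x).hasFDerivAt.neg.exp
    rw [hd.fderiv]
    simp [mul_comm]
  have h := integral_mul_fderiv_eq_neg_fderiv_mul_of_integrable (μ := volume) (f := f)
    (g := fun x => Real.exp (-U x)) (v := v)
    (integrable_mul_exp_neg hm hUd.continuous hmin (by fun_prop) hfC₁)
    (by
      simp_rw [hder]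
      refine (integrable_mul_exp_neg hm hUd.continuous hmin (by fun_prop) hfC₂).neg.congr
        (Filter.Eventually.of_forall fun x => ?_)
      simp [mul_assoc])
    (integrable_mul_exp_neg hm hUd.continuous hmin (by fun_prop) hfC)
    (fun x _ => hf.differentiable (by norm_num) x) (fun x _ => by fun_prop)
  simp_rw [hder, mul_neg, integral_neg, neg_inj, ← mul_assoc] at h
  exact h

/-- Cramér–Rao type lower bound for the variance of a coordinate under `target U`. -/
lemma two_mul_sub_le_variance_coord (hm : 0 < m) (hU : IsRegularPotential U m L)
    {c : EuclideanSpace ℝ (Fin d)} (hmin : ∀ y, U c + m / 2 * ‖y - c‖ ^ 2 ≤ U y)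
    (j : Fin d) :
    MemLp (fun x : EuclideanSpace ℝ (Fin d) => x j) 2 (target U) ∧
    ∀ a : ℝ, 2 * a - a ^ 2 * L ≤ Var[fun x : EuclideanSpace ℝ (Fin d) => x j; target U] := by
  have hUd : Differentiable ℝ U := hU.contDiff.differentiable (by norm_num)
  have hUc := hUd.continuous
  have hUf : Continuous (fderiv ℝ U) := hU.contDiff.continuous_fderiv (by norm_num)
  have hi := integrable_exp_neg hm hUc hmin
  have hprob : IsProbabilityMeasure (target U) := isProbabilityMeasure_tilted hi
  set v : EuclideanSpace ℝ (Fin d) := EuclideanSpace.single j 1 with hv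
  have hv1 : ‖v‖ = 1 := by simp [v]
  have h0 := fderiv_minimizer_eq_zero hm hmin
  have hL : 0 ≤ L := by
    have := (norm_nonneg _).trans (norm_fderiv_sub_le hU (c + v) c)
    simpa [hv1] using this
  set G : EuclideanSpace ℝ (Fin d) → ℝ := fun x => fderiv ℝ U x v with hG
  have hGd : ContDiff ℝ 1 G := (hU.contDiff.fderiv_right (m := 1) (by norm_num)).clm_apply
    contDiff_const
  have hGlip : LipschitzWith (Real.toNNReal L) G := by
    refine LipschitzWith.of_dist_le_mul fun x y => ?_
    rw [Real.coe_toNNReal L hL, dist_eq_norm, dist_eq_norm]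
    calc ‖G x - G y‖ = ‖(fderiv ℝ U x - fderiv ℝ U y) v‖ := by simp [hG]
      _ ≤ ‖fderiv ℝ U x - fderiv ℝ U y‖ * ‖v‖ := ContinuousLinearMap.le_opNorm _ _
      _ ≤ _ := by rw [hv1, mul_one]; exact norm_fderiv_sub_le hU x y
  have hGb : ∀ x, |G x| ≤ L * ‖x - c‖ := by
    intro x
    have := hGlip.dist_le_mul x c
    rw [Real.coe_toNNReal L hL, dist_eq_norm, dist_eq_norm] at this
    simpa [hG, h0] using this
  have hG' : ∀ x, |fderiv ℝ G x v| ≤ L := by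
    intro x
    have h1 := norm_fderiv_le_of_lipschitz ℝ hGlip (x₀ := x)
    rw [Real.coe_toNNReal L hL] at h1
    calc |fderiv ℝ G x v| ≤ ‖fderiv ℝ G x‖ * ‖v‖ := (fderiv ℝ G x).le_opNorm v
      _ ≤ L := by rw [hv1, mul_one]; exact h1
  set μ := ∫ x : EuclideanSpace ℝ (Fin d), x j ∂(target U) with hμ
  set f : EuclideanSpace ℝ (Fin d) → ℝ := fun x => x j - μ with hf
  have hfd : ContDiff ℝ 1 f := by fun_prop
  have hf' : ∀ x, fderiv ℝ f x v = 1 := by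
    intro x
    have : HasFDerivAt f (EuclideanSpace.proj j : EuclideanSpace ℝ (Fin d) →L[ℝ] ℝ) x :=
      (EuclideanSpace.proj j : EuclideanSpace ℝ (Fin d) →L[ℝ] ℝ).hasFDerivAt.sub_const μ
    rw [this.fderiv]
    simp [v]
  have hfb : ∀ x, |f x| ≤ ‖x - c‖ + |c j - μ| := by
    intro x
    have h1 : |x j - c j| ≤ ‖x - c‖ := by simpa using PiLp.norm_apply_le (x - c) j
    calc |f x| = |(x j - c j) + (c j - μ)| := by simp [hf]
      _ ≤ _ := (abs_add_le _ _).trans (by linarith)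
  set B := |c j - μ|
  have hB : 0 ≤ B := abs_nonneg _
  have hr : ∀ x : EuclideanSpace ℝ (Fin d), ‖x - c‖ ≤ 1 + ‖x - c‖ ^ 2 := fun x => by
    nlinarith [sq_nonneg (‖x - c‖ - 1)]
  have hfq : ∀ x, |f x| ≤ (1 + B) * (1 + ‖x - c‖ ^ 2) := fun x => by
    nlinarith [hfb x, hr x, sq_nonneg ‖x - c‖]
  have hGq : ∀ x, |G x| ≤ L * (1 + ‖x - c‖ ^ 2) := fun x =>
    (hGb x).trans (by gcongr; exact hr x)
  have hfG : ∀ x, |f x * G x| ≤ (L * (1 + B)) * (1 + ‖x - c‖ ^ 2) := fun x => by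
    rw [abs_mul]
    calc |f x| * |G x| ≤ (‖x - c‖ + B) * (L * ‖x - c‖) := by
          gcongr
          · exact hfb x
          · exact hGb x
      _ = L * (‖x - c‖ ^ 2 + B * ‖x - c‖) := by ring
      _ ≤ L * ((1 + B) * (1 + ‖x - c‖ ^ 2)) := by
          gcongr
          nlinarith [hr x]
      _ = _ := by ring
  have hGG : ∀ x, |G x * G x| ≤ L ^ 2 * (1 + ‖x - c‖ ^ 2) := fun x => by
    rw [abs_mul]
    calc |G x| * |G x| ≤ (L * ‖x - c‖) * (L * ‖x - c‖) := by
          gcongr <;> exact hGb x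
      _ ≤ _ := by nlinarith [sq_nonneg L]
  have hff : ∀ x, |f x * f x| ≤ (2 * (1 + B ^ 2)) * (1 + ‖x - c‖ ^ 2) := fun x => by
    rw [abs_mul]
    calc |f x| * |f x| ≤ (‖x - c‖ + B) * (‖x - c‖ + B) := by
          gcongr <;> exact hfb x
      _ ≤ _ := by nlinarith [sq_nonneg (‖x - c‖ - B), mul_nonneg (sq_nonneg B) (sq_nonneg ‖x - c‖)]
  have hfc : Continuous f := hfd.continuous
  have hGc : Continuous G := hGd.continuous
  have hG'c : Continuous fun x => fderiv ℝ G x v :=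
    (hGd.continuous_fderiv (by norm_num)).clm_apply continuous_const
  set Z := ∫ x, Real.exp (-U x) with hZ
  have hZ0 : 0 < Z := integral_exp_pos hi
  have hint : ∀ {g : EuclideanSpace ℝ (Fin d) → ℝ} {C : ℝ}, Continuous g →
      (∀ x, |g x| ≤ C * (1 + ‖x - c‖ ^ 2)) → Integrable g (target U) := by
    intro g C hg hC
    rw [target, integrable_tilted_iff hi]
    refine (integrable_mul_exp_neg hm hUc hmin hg hC).congr
      (Filter.Eventually.of_forall fun x => ?_)
    simp [mul_comm]
  have hto : ∀ g : EuclideanSpace ℝ (Fin d) → ℝ,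
      ∫ x, g x ∂(target U) = (∫ x, g x * Real.exp (-U x)) / Z := by
    intro g
    rw [target, integral_tilted, ← integral_div]
    refine integral_congr_ae (Filter.Eventually.of_forall fun x => ?_)
    simp only [smul_eq_mul, ← hZ]
    ring
  -- Integration by parts moves the score `G = ∂_v U` onto `f` (here) and onto itself (`e2`),
  -- leaving `∂_v f = 1` and `∂_v G ≤ L`.
  have e1 : ∫ x, f x * G x ∂(target U) = 1 := by
    rw [hto, integral_fderiv_mul_exp_neg hm hU hmin v hfd hfq (C₁ := 1)
      (fun x => by rw [hf', abs_one]; nlinarith [sq_nonneg ‖x - c‖]) hfG]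
    simp_rw [hf', one_mul]
    exact div_self hZ0.ne'
  have e2 : ∫ x, G x * G x ∂(target U) ≤ L := by
    have hG'q : ∀ x, |fderiv ℝ G x v| ≤ L * (1 + ‖x - c‖ ^ 2) := fun x => by
      nlinarith [hG' x, mul_nonneg hL (sq_nonneg ‖x - c‖)]
    rw [hto, integral_fderiv_mul_exp_neg hm hU hmin v hGd hGq hG'q hGG, ← hto]
    calc _ ≤ ∫ _, L ∂(target U) := integral_mono (hint hG'c hG'q) (integrable_const L)
          fun x => (le_abs_self _).trans (hG' x)
      _ = L := by simp
  have hLp : MemLp f 2 (target U) := by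
    rw [memLp_two_iff_integrable_sq hfc.aestronglyMeasurable]
    refine (hint (hfc.mul hfc) hff).congr (Filter.Eventually.of_forall fun x => ?_)
    simp [sq]
  have hLp' : MemLp (fun x : EuclideanSpace ℝ (Fin d) => x j) 2 (target U) := by
    have := hLp.add (memLp_const μ)
    refine this.congr_norm (by fun_prop) (Filter.Eventually.of_forall fun x => ?_)
    simp [hf]
  refine ⟨hLp', fun a => ?_⟩
  have hvar : Var[fun x : EuclideanSpace ℝ (Fin d) => x j; target U] =
      ∫ x, f x * f x ∂(target U) := by
    rw [variance_eq_integral (by fun_prop)]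
    simp only [hf, ← hμ, sq]
  have i1 : Integrable (fun x => f x * f x) (target U) := hint (hfc.mul hfc) hff
  have i2 : Integrable (fun x => 2 * a * (f x * G x)) (target U) :=
    (hint (hfc.mul hGc) hfG).const_mul _
  have i3 : Integrable (fun x => a ^ 2 * (G x * G x)) (target U) :=
    (hint (hGc.mul hGc) hGG).const_mul _
  -- Expanding `∫ (f - aG)² ≥ 0` replaces Cauchy–Schwarz and needs no division.
  have hpos : 0 ≤ ∫ x, (f x * f x - 2 * a * (f x * G x)) + a ^ 2 * (G x * G x) ∂(target U) :=
    integral_nonneg fun x => by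
      have := sq_nonneg (f x - a * G x)
      simp only [Pi.zero_apply]
      linarith
  have i12 : Integrable (fun x => f x * f x - 2 * a * (f x * G x)) (target U) := i1.sub i2
  rw [integral_add i12 i3, integral_sub i1 i2,
    integral_const_mul, integral_const_mul, e1, ← hvar] at hpos
  nlinarith [mul_le_mul_of_nonneg_left e2 (sq_nonneg a)]

end CramerRao

/-! ### The bound from the mean squared displacement. -/

section Dirichlet

variable {d K : ℕ}

/-- The concave function `log` lies below its tangent at `t`. This bounds a maximum `u` by an
expression linear in `S`, whose expectation needs only the marginals. -/
lemma le_log_add_div_sub_one {u S t : ℝ} (ht : 0 < t) (h : Real.exp u ≤ S) :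
    u ≤ S / t + Real.log t - 1 := by
  have := Real.add_one_le_exp (u - Real.log t)
  rw [Real.exp_sub, Real.exp_log ht] at this
  have h2 : Real.exp u / t ≤ S / t := by gcongr
  linarith

/-- Mean squared displacement of a coordinate: the contribution of the best of `K` proposals. -/
lemma lintegral_sq_mpKernel_le (hK : 1 ≤ K) {σ : ℝ} (hσ : 0 < σ)
    {Q : Kernel (EuclideanSpace ℝ (Fin d)) (Fin K → EuclideanSpace ℝ (Fin d))} [IsMarkovKernel Q]
    (h : SelectionRule (EuclideanSpace ℝ (Fin d)) K) (hQ : HasRandomWalkMarginals Q σ)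
    (x : EuclideanSpace ℝ (Fin d)) (j : Fin d) :
    ∫⁻ y, ENNReal.ofReal ((y j - x j) ^ 2) ∂(mpKernel Q h x) ≤
      ENNReal.ofReal (4 * σ ^ 2 * (1 / 2 + Real.log K)) := by
  have hK0 : (0 : ℝ) < K := by exact_mod_cast hK
  -- `t` is the mean of `∑ i, E i`, so the terms `S / t - 1` cancel in expectation and only `log t =
  -- log K + (log 2) / 2` remains.
  set t : ℝ := K * Real.sqrt 2 with ht
  have ht0 : 0 < t := by positivity
  set E : Fin K → (Fin K → EuclideanSpace ℝ (Fin d)) → ℝ := fun i y =>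
    Real.exp (((y i j - x j) / σ) ^ 2 / 4) with hE
  set F : (Fin K → EuclideanSpace ℝ (Fin d)) → ℝ := fun y =>
    4 * σ ^ 2 * ((∑ i, E i y) / t + Real.log t - 1) with hF
  have hbound : ∀ y i, (y i j - x j) ^ 2 ≤ F y := by
    intro y i
    have h1 := le_log_add_div_sub_one ht0 (Finset.single_le_sum (f := fun i => E i y)
      (fun i _ => (Real.exp_pos _).le) (Finset.mem_univ i))
    calc (y i j - x j) ^ 2 = 4 * σ ^ 2 * (((y i j - x j) / σ) ^ 2 / 4) := by field_simp
      _ ≤ _ := by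
        simp only [hF]
        gcongr
  have hF0 : ∀ y, 0 ≤ F y := fun y => (sq_nonneg _).trans (hbound y ⟨0, hK⟩)
  have hEm : ∀ i, Measurable (E i) := fun i => by
    simp only [hE]
    fun_prop
  have hEi : ∀ i, Integrable (E i) (Q x) ∧ ∫ y, E i y ∂(Q x) = Real.sqrt 2 := by
    intro i
    have hm : Measurable fun y : Fin K → EuclideanSpace ℝ (Fin d) => (y i j - x j) / σ :=
      (show Measurable fun z : EuclideanSpace ℝ (Fin d) => (z j - x j) / σ by fun_prop).comp
        (measurable_pi_apply i)
    have hmap : (Q x).map (fun y => (y i j - x j) / σ) = gaussianReal 0 1 := by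
      rw [← map_coord_multivariateGaussian x hσ j, ← hQ x i,
        Measure.map_map (by fun_prop) (by fun_prop)]
      rfl
    have hg := integral_exp_sq_div_four_gaussianReal
    rw [← hmap] at hg
    constructor
    · exact (integrable_map_measure (by fun_prop) hm.aemeasurable).1 hg.1
    · rw [← hg.2, integral_map hm.aemeasurable (by fun_prop)]
  have hSi : Integrable (fun y => ∑ i, E i y) (Q x) :=
    integrable_finsetSum _ fun i _ => (hEi i).1
  have hFi : Integrable F (Q x) :=
    ((((hSi.div_const t).add (integrable_const (Real.log t))).sub
      (integrable_const 1))).const_mul (4 * σ ^ 2)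
  have hFint : ∫ y, F y ∂(Q x) = 4 * σ ^ 2 * Real.log t := by
    simp only [hF]
    rw [integral_const_mul, integral_sub (by fun_prop) (by fun_prop),
      integral_add (by fun_prop) (by fun_prop), integral_div,
      integral_finsetSum _ fun i _ => (hEi i).1]
    simp only [(hEi _).2, Finset.sum_const, Finset.card_univ, Fintype.card_fin, nsmul_eq_mul,
      integral_const, probReal_univ, one_smul]
    rw [← ht, div_self ht0.ne']
    ring
  have hmeas : Measurable fun y : EuclideanSpace ℝ (Fin d) => ENNReal.ofReal ((y j - x j) ^ 2) := by
    fun_prop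
  calc _ = ∫⁻ y, ∫⁻ w, ENNReal.ofReal ((w j - x j) ^ 2) ∂(selectionKernel h (x, y)) ∂(Q x) := by
        rw [mpKernel, Kernel.lintegral_comp _ _ _ hmeas, Kernel.prod_apply, Kernel.id_apply,
          lintegral_prod _ (hmeas.lintegral_kernel).aemeasurable,
          lintegral_dirac' _ (Measurable.lintegral_prod_right' hmeas.lintegral_kernel)]
    _ ≤ ∫⁻ y, ENNReal.ofReal (F y) ∂(Q x) := by
        refine lintegral_mono fun y => ?_
        simp only [selectionKernel, Kernel.coe_mk, lintegral_add_measure,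
          lintegral_finsetSum_measure, lintegral_smul_measure, smul_eq_mul,
          lintegral_dirac' _ hmeas, sub_self]
        simp only [ne_eq, OfNat.ofNat_ne_zero, not_false_eq_true, zero_pow, ENNReal.ofReal_zero,
          mul_zero, add_zero]
        calc _ ≤ ∑ i, ENNReal.ofReal (h.prob x y i) * ENNReal.ofReal (F y) := by
              gcongr with i
              exact hbound y i
          _ = ENNReal.ofReal (∑ i, h.prob x y i) * ENNReal.ofReal (F y) := by
              rw [← Finset.sum_mul, ENNReal.ofReal_sum_of_nonneg fun i _ => h.prob_nonneg x y i]
          _ ≤ _ := mul_le_of_le_one_left' (ENNReal.ofReal_le_one.2 (h.sum_prob_le_one x y))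
    _ = ENNReal.ofReal (∫ y, F y ∂(Q x)) :=
        (ofReal_integral_eq_lintegral_ofReal hFi (Filter.Eventually.of_forall hF0)).symm
    _ ≤ _ := by
        rw [hFint]
        apply ENNReal.ofReal_le_ofReal
        gcongr
        rw [ht, Real.log_mul hK0.ne' (by positivity), Real.log_sqrt (by norm_num)]
        have := Real.log_two_lt_d9
        linarith

/-- The spectral gap is limited by the mean squared displacement. -/
lemma spectralGap_mpKernel_le_displacement (hd : 1 ≤ d) (hK : 1 ≤ K)
    {U : EuclideanSpace ℝ (Fin d) → ℝ} {m L : ℝ} (hm : 0 < m) (hU : IsRegularPotential U m L)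
    {c : EuclideanSpace ℝ (Fin d)} (hmin : ∀ y, U c + m / 2 * ‖y - c‖ ^ 2 ≤ U y)
    {σ : ℝ} (hσ : 0 < σ)
    {Q : Kernel (EuclideanSpace ℝ (Fin d)) (Fin K → EuclideanSpace ℝ (Fin d))} [IsMarkovKernel Q]
    {h : SelectionRule (EuclideanSpace ℝ (Fin d)) K} (hQ : HasRandomWalkMarginals Q σ) :
    spectralGap (mpKernel Q h) (target U) ≤
      ENNReal.ofReal (2 * (σ ^ 2 * L * (1 / 2 + Real.log K))) := by
  have hL : 0 < L := by
    have := strongConvexity_le_two_mul_smoothness hd hm hU hmin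
    linarith
  have hprob : IsProbabilityMeasure (target U) := isProbabilityMeasure_tilted
    (integrable_exp_neg hm hU.contDiff.continuous hmin)
  obtain ⟨hLp, hvar⟩ := two_mul_sub_le_variance_coord hm hU hmin ⟨0, hd⟩
  -- `a = 1 / L` maximises `2a - a² L`.
  have hvar' : 1 / L ≤ Var[fun x : EuclideanSpace ℝ (Fin d) => x ⟨0, hd⟩; target U] := by
    refine le_trans (le_of_eq ?_) (hvar (1 / L))
    field_simp
    norm_num
  have hev : ENNReal.ofReal (1 / L) ≤
      evariance (fun x : EuclideanSpace ℝ (Fin d) => x ⟨0, hd⟩) (target U) := by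
    rw [← hLp.ofReal_variance_eq]
    exact ENNReal.ofReal_le_ofReal hvar'
  have hev0 : 0 < ENNReal.ofReal (1 / L) := ENNReal.ofReal_pos.2 (by positivity)
  have hlog : 0 ≤ Real.log K := Real.log_natCast_nonneg K
  refine iInf_le_of_le _ (iInf_le_of_le hLp (iInf_le_of_le (hev0.trans_le hev).ne' ?_))
  refine ENNReal.div_le_of_le_mul ?_
  calc _ ≤ ∫⁻ _, ENNReal.ofReal (4 * σ ^ 2 * (1 / 2 + Real.log K)) ∂(target U) :=
        lintegral_mono fun x => lintegral_sq_mpKernel_le hK hσ h hQ x _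
    _ = ENNReal.ofReal (4 * σ ^ 2 * (1 / 2 + Real.log K)) := by simp
    _ = ENNReal.ofReal (2 * (σ ^ 2 * L * (1 / 2 + Real.log K))) *
          (2 * ENNReal.ofReal (1 / L)) := by
        rw [← ENNReal.ofReal_ofNat 2, ← ENNReal.ofReal_mul (by norm_num),
          ← ENNReal.ofReal_mul (by positivity)]
        congr 1
        field_simp
        norm_num
    _ ≤ _ := by gcongr

end Dirichlet

end MultiProposal

/-! ### Optimising over the step size. -/

namespace MultiProposal

/-- Large step sizes: the acceptance bound is at most `1 / d` as soon as
`m σ² ≥ 4 (log K + log d) / d`. -/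
lemma div_rpow_le_inv {K d a s : ℝ} (hK : 0 < K) (hd : 0 < d) (ha : a = Real.log K + Real.log d)
    (ha0 : 0 < a) (had : 4 * a ≤ d) (hs : 4 * a / d ≤ s) :
    K / (1 + s) ^ (d / 2) ≤ 1 / d := by
  set x := 4 * a / d with hx
  have hx0 : 0 < x := by positivity
  have hx1 : x ≤ 1 := (div_le_one hd).2 had
  -- From `e^{-x/2} ≥ 1 - x/2` and `(1 + x)(1 - x/2) ≥ 1`, which holds for `0 ≤ x ≤ 1`.
  have h1 : Real.exp (x / 2) ≤ 1 + x := by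
    have e1 := Real.add_one_le_exp (-(x / 2))
    have e2 : Real.exp (x / 2) * Real.exp (-(x / 2)) = 1 := by rw [← Real.exp_add]; simp
    nlinarith [Real.exp_pos (x / 2)]
  have h2 : K * d ≤ (1 + s) ^ (d / 2) := by
    calc K * d = Real.exp (x / 2 * (d / 2)) := by
          rw [show x / 2 * (d / 2) = Real.log K + Real.log d by rw [hx, ← ha]; field_simp; ring,
            Real.exp_add, Real.exp_log hK, Real.exp_log hd]
      _ = Real.exp (x / 2) ^ (d / 2) := by rw [Real.exp_mul]
      _ ≤ _ := Real.rpow_le_rpow (Real.exp_pos _).le (by linarith) (by positivity)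
  rw [div_le_div_iff₀ (lt_of_lt_of_le (by positivity) h2) hd]
  linarith

end MultiProposal

theorem theorem3 {d K : ℕ} (hd : 1 ≤ d) (hK : 1 ≤ K)
    (U : EuclideanSpace ℝ (Fin d) → ℝ) (m L : ℝ) (hm : 0 < m)
    (hU : MultiProposal.IsRegularPotential U m L) :
    (∀ (σ : ℝ), 0 < σ →
      ∀ (Q : Kernel (EuclideanSpace ℝ (Fin d)) (Fin K → EuclideanSpace ℝ (Fin d)))
        (h : MultiProposal.SelectionRule (EuclideanSpace ℝ (Fin d)) K),
        MultiProposal.IsRandomWalkScheme U σ Q h →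
        MultiProposal.spectralGap (MultiProposal.mpKernel Q h) (MultiProposal.target U) ≤
          ENNReal.ofReal (2 * min ((K : ℝ) / (1 + m * σ ^ 2) ^ ((d : ℝ) / 2))
            (σ ^ 2 * L * (1 / 2 + Real.log K)))) ∧
    (2 < d → 2 < K →
      ∀ (Q : ℝ → Kernel (EuclideanSpace ℝ (Fin d)) (Fin K → EuclideanSpace ℝ (Fin d)))
        (h : ℝ → MultiProposal.SelectionRule (EuclideanSpace ℝ (Fin d)) K),
        (∀ σ : ℝ, 0 < σ → MultiProposal.IsRandomWalkScheme U σ (Q σ) (h σ)) →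
        (⨆ (σ : ℝ) (_ : 0 < σ),
          MultiProposal.spectralGap (MultiProposal.mpKernel (Q σ) (h σ))
            (MultiProposal.target U)) ≤
          ENNReal.ofReal (4 * Real.exp 1.04 * (L / m) *
            ((Real.log K + Real.log d) ^ 2 / d))) := by
  have hc := hU.contDiff.continuous
  obtain ⟨c, hmin⟩ := MultiProposal.exists_quadratic_growth hm hc hU.strongConvexOn
  have hmL := MultiProposal.strongConvexity_le_two_mul_smoothness hd hm hU hmin
  refine ⟨fun σ hσ Q h hQ => ?_, fun hd2 hK2 Q h hQ => iSup₂_le fun σ hσ => ?_⟩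
  · have := hQ.isMarkovKernel
    rcases min_choice ((K : ℝ) / (1 + m * σ ^ 2) ^ ((d : ℝ) / 2))
      (σ ^ 2 * L * (1 / 2 + Real.log K)) with e | e <;> rw [e]
    · exact MultiProposal.spectralGap_mpKernel_le_mode hd hm hc hmin hσ hQ.marginals hQ.reversible
    · exact MultiProposal.spectralGap_mpKernel_le_displacement hd hK hm hU hmin hσ hQ.marginals
  have := (hQ σ hσ).isMarkovKernel
  have hrev := (hQ σ hσ).reversible
  have hd3 : (3 : ℝ) ≤ d := by exact_mod_cast hd2
  have hK3 : (3 : ℝ) ≤ K := by exact_mod_cast hK2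
  have hlog : ∀ x : ℝ, 3 ≤ x → 1 ≤ Real.log x := fun x hx => by
    rw [Real.le_log_iff_exp_le (by linarith)]
    linarith [Real.exp_one_lt_d9]
  have hlK := hlog K hK3
  have hld := hlog d hd3
  set a := Real.log K + Real.log d with ha
  have hLm : 1 / 2 ≤ L / m := by
    rw [div_le_div_iff₀ (by norm_num) hm]
    linarith
  -- Only `e^{1.04} ≥ 2` is needed: with `L / m ≥ 1/2`, the target dominates both `8 (L/m) a²/d` and
  -- `4 a²/d`.
  have hexp : 2 ≤ Real.exp 1.04 := by
    have := Real.add_one_le_exp (1.04 : ℝ)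
    linarith
  have hd0 : (0 : ℝ) < d := by linarith
  have hq : 0 ≤ a ^ 2 / d := by positivity
  have hT : 8 * (L / m) * (a ^ 2 / d) ≤ 4 * Real.exp 1.04 * (L / m) * (a ^ 2 / d) := by
    gcongr
    linarith
  have hT' : 4 * (a ^ 2 / d) ≤ 4 * Real.exp 1.04 * (L / m) * (a ^ 2 / d) :=
    le_trans (by gcongr; linarith) hT
  -- In this case `4 a²/d ≥ 2`. Otherwise `d > 2a² ≥ 4a`, because `a ≥ 2`, which is the hypothesis
  -- required by `div_rpow_le_inv`.
  by_cases hbig : (d : ℝ) ≤ 2 * a ^ 2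
  · refine (MultiProposal.spectralGap_mpKernel_le_two hd hc
      (MultiProposal.integrable_exp_neg hm hc hmin) hrev).trans ?_
    rw [← ENNReal.ofReal_ofNat 2]
    apply ENNReal.ofReal_le_ofReal
    refine le_trans ?_ hT'
    have : 1 / 2 ≤ a ^ 2 / d := by
      rw [div_le_div_iff₀ (by norm_num) hd0]
      linarith
    linarith
  -- Below the threshold `1/2 + log K ≤ a`, since `log d ≥ 1`, and the displacement bound gives `8
  -- (L/m) a²/d`. Above it the mode bound gives `2/d`.
  rcases le_total (m * σ ^ 2) (4 * a / d) with hs | hs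
  · refine (MultiProposal.spectralGap_mpKernel_le_displacement hd hK hm hU hmin hσ
      (hQ σ hσ).marginals).trans (ENNReal.ofReal_le_ofReal (le_trans ?_ hT))
    calc 2 * (σ ^ 2 * L * (1 / 2 + Real.log K))
        = 2 * (L / m) * (m * σ ^ 2) * (1 / 2 + Real.log K) := by field_simp
      _ ≤ 2 * (L / m) * (4 * a / d) * a := by
          gcongr
          linarith
      _ = _ := by ring
  · refine (MultiProposal.spectralGap_mpKernel_le_mode hd hm hc hmin hσ
      (hQ σ hσ).marginals hrev).trans (ENNReal.ofReal_le_ofReal (le_trans ?_ hT'))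
    have := MultiProposal.div_rpow_le_inv (by linarith) hd0 ha (by linarith) (by nlinarith) hs
    calc _ ≤ 2 * (1 / (d : ℝ)) := by gcongr
      _ ≤ 4 * (a ^ 2 / d) := by
        rw [← mul_div_assoc, ← mul_div_assoc]
        exact div_le_div_of_nonneg_right (by nlinarith) hd0.le
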